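/- Let $f$ be a $\nu$-self-concordant barrier ($\nu>0$) on $\mathbb{R}^n$: a closed convex function that is $C^3$ on its open convex domain $\operatorname{dom} f$, such that every restriction $\varphi(\tau)=f(x+\tau v)$ to a line satisfies $|\varphi'''|\le 2(\varphi'')^{3/2}$, and such that $2\nabla f(x)^Tu-u^T\nabla^2 f(x)u\le\nu$ for all $x\in\operatorname{dom} f$ and $u\in\mathbb{R}^n$. Assume that $\nabla^2 f(x)\succ 0$ for all $x\in\operatorname{dom} f$, and let $g:\mathbb{R}^n\to\mathbb{R}\cup\{+\infty\}$ be proper, lower semicontinuous and convex. For $t>0$ put $F(x;t)=f(x)+t^{-1}g(x)$, $\operatorname{dom} F=\operatorname{dom} f\cap\operatorname{dom} g$, and $\|u\|_x=(u^T\nabla^2 f(x)u)^{1/2}$ for $x\in\operatorname{dom} f$. Let $t_k,t_{k+1}>0$ be such that $F(\cdot;t_k)$ and $F(\cdot;t_{k+1})$ have minimizers $x^*_{t_k}$ and $x^*_{t_{k+1}}$ in $\operatorname{dom} F$. Let $x_{t_k}\in\operatorname{dom} F$, let $\delta_k\ge 0$, and let $x_{t_{k+1}}$ be obtained from $x_{t_k}$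 by one inexact proximal-Newton step with accuracy $\delta_k$; that is, $x_{t_{k+1}}\in\operatorname{dom} F$ and $$\widehat F(x_{t_{k+1}})-\inf_{y\in\operatorname{dom} F}\widehat F(y)\le \frac{\delta_k^2}{2},$$ where $$\widehat F(y)=f(x_{t_k})+\nabla f(x_{t_k})^T(y-x_{t_k})+\tfrac12(y-x_{t_k})^T\nabla^2 f(x_{t_k})(y-x_{t_k})+t_{k+1}^{-1}g(y).$$ Set $$\lambda^+_{t_k}=\|x_{t_k}-x^*_{t_k}\|_{x^*_{t_k}},\quad \Delta_k=\|x^*_{t_{k+1}}-x^*_{t_k}\|_{x^*_{t_{k+1}}},\quad \lambda_{t_{k+1}}=\|x_{t_k}-x^*_{t_{k+1}}\|_{x^*_{t_{k+1}}},\quad \lambda^+_{t_{k+1}}=\|x_{t_{k+1}}-x^*_{t_{k+1}}\|_{x^*_{t_{k+1}}}.$$ Theorem 4.1. Let $\beta\in(0,0.15]$, and suppose that $$\delta_k\le 0.075\,\beta,\qquad \Delta_k\le\frac{\sqrt\beta-2.581\,\beta}{2.581+\sqrt\beta},\qquad \lambda^+_{t_k}\le\beta.$$ Then $$\lambda_{t_{k+1}}\le\frac{1}{2.581}\sqrt\beta\qquad\text{and}\qquad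 \lambda^+_{t_{k+1}}\le\beta.$$ In particular, $x_{t_{k+1}}$ belongs to the quadratic convergence region $\{x\in\operatorname{dom} F : \|x-x^*_{t_{k+1}}\|_{x^*_{t_{k+1}}}\le\beta\}$. -/

import Mathlib

namespace ProxNewton

/-- The real space `ℝⁿ` with its Euclidean structure. -/
abbrev Vec (n : ℕ) := EuclideanSpace ℝ (Fin n)

/-- The value `uᵀ ∇²f(x) v` of the Hessian form of `f` at `x`. -/
noncomputable def hess {n : ℕ} (f : Vec n → ℝ) (x u v : Vec n) : ℝ :=
  fderiv ℝ (fderiv ℝ f) x u v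

/-- The local norm `‖u‖_x = (uᵀ ∇²f(x) u)^{1/2}`. -/
noncomputable def localNorm {n : ℕ} (f : Vec n → ℝ) (x u : Vec n) : ℝ :=
  Real.sqrt (hess f x u u)

/-- `φ` is a standard self-concordant function of one real variable on `I`:
it is convex and `|φ'''| ≤ 2 (φ'')^{3/2}` on `I`. -/
def IsStdSelfConcordantOn (φ : ℝ → ℝ) (I : Set ℝ) : Prop :=
  ConvexOn ℝ I φ ∧
    ∀ τ ∈ I, |iteratedDeriv 3 φ τ| ≤ 2 * (iteratedDeriv 2 φ τ) ^ ((3 : ℝ) / 2)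

/-- `f`, with `dom f = D`, is self-concordant: it is a closed (lower semicontinuous) convex
function, of class `C³` on its open domain `D`, and every restriction of `f` to a line is standard
self-concordant. The values of `f` outside `D` play no role (there `f` is understood
to be `+∞`). -/
structure IsSelfConcordant {n : ℕ} (f : Vec n → ℝ) (D : Set (Vec n)) : Prop where
  isOpen_dom : IsOpen D
  convexOn : ConvexOn ℝ D f
  contDiffOn : ContDiffOn ℝ 3 f D
  isClosed_sublevel : ∀ a : ℝ, IsClosed {x | x ∈ D ∧ f x ≤ a}
  line : ∀ x ∈ D, ∀ v : Vec n,
    IsStdSelfConcordantOn (fun τ : ℝ => f (x + τ • v)) {τ : ℝ | x + τ • v ∈ D}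

/-- `f`, with `dom f = D`, is a `ν`-self-concordant barrier (for the closure of `D`):
it is self-concordant and `sup_u (2 ∇f(x)ᵀ u - ‖u‖_x²) ≤ ν` for all `x ∈ D`. -/
structure IsSelfConcordantBarrier {n : ℕ} (f : Vec n → ℝ) (D : Set (Vec n)) (ν : ℝ) : Prop where
  selfConcordant : IsSelfConcordant f D
  param_pos : 0 < ν
  barrier : ∀ x ∈ D, ∀ u : Vec n, 2 * fderiv ℝ f x u - hess f x u u ≤ ν

/-- `g : ℝⁿ → ℝ ∪ {+∞}` is proper, lower semicontinuous and convex. -/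
structure IsProperClosedConvex {n : ℕ} (g : Vec n → EReal) : Prop where
  ne_bot : ∀ x, g x ≠ ⊥
  exists_ne_top : ∃ x, g x ≠ ⊤
  lsc : LowerSemicontinuous g
  convex_epigraph : Convex ℝ {p : Vec n × ℝ | g p.1 ≤ (p.2 : EReal)}

/-- `dom F = dom f ∩ dom g`, where `dom f = D`. -/
def domF {n : ℕ} (D : Set (Vec n)) (g : Vec n → EReal) : Set (Vec n) :=
  {x | x ∈ D ∧ g x < ⊤}

/-- The objective `F(x; t) = f(x) + t⁻¹ g(x)`, used for `x ∈ dom F` only. -/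
noncomputable def objective {n : ℕ} (f : Vec n → ℝ) (g : Vec n → EReal) (t : ℝ) (x : Vec n) : ℝ :=
  f x + t⁻¹ * (g x).toReal

/-- `xs` is an exact solution `x*_t` of `min_x F(x; t)`. -/
def IsExactSolution {n : ℕ} (f : Vec n → ℝ) (D : Set (Vec n)) (g : Vec n → EReal) (t : ℝ)
    (xs : Vec n) : Prop :=
  xs ∈ domF D g ∧ ∀ y ∈ domF D g, objective f g t xs ≤ objective f g t y

/-- The second order Taylor model `Q(x; x₀)` of `f` around `x₀`. -/
noncomputable def quadModel {n : ℕ} (f : Vec n → ℝ) (x₀ x : Vec n) : ℝ :=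
  f x₀ + fderiv ℝ f x₀ (x - x₀) + 1 / 2 * hess f x₀ (x - x₀) (x - x₀)

/-- The proximal-Newton model `F̂(x; t, x₀) = Q(x; x₀) + t⁻¹ g(x)`, used for `x ∈ dom F` only. -/
noncomputable def model {n : ℕ} (f : Vec n → ℝ) (g : Vec n → EReal) (t : ℝ) (x₀ x : Vec n) : ℝ :=
  quadModel f x₀ x + t⁻¹ * (g x).toReal

/-- `xbar` is an exact solution of the subproblem `min {F̂(x; t, x₀) : x ∈ dom F}`. -/
def IsExactStep {n : ℕ} (f : Vec n → ℝ) (D : Set (Vec n)) (g : Vec n → EReal) (t : ℝ)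
    (x₀ xbar : Vec n) : Prop :=
  xbar ∈ domF D g ∧ ∀ y ∈ domF D g, model f g t x₀ xbar ≤ model f g t x₀ y

/-- `xp` is a `δ`-solution of the subproblem `min {F̂(x; t, x₀) : x ∈ dom F}`, that is, the result
of one inexact full proximal-Newton step from `x₀` with parameter `t` and accuracy `δ`: its model
value exceeds the minimum by at most `δ² / 2`. The minimum is expressed by comparison with all
points of `dom F`, so that its attainment need not be assumed;
see `isInexactStep_iff_of_isExactStep`. -/
def IsInexactStep {n : ℕ} (f : Vec n → ℝ) (D : Set (Vec n)) (g : Vec n → EReal) (t δ : ℝ)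
    (x₀ xp : Vec n) : Prop :=
  xp ∈ domF D g ∧ ∀ y ∈ domF D g, model f g t x₀ xp - model f g t x₀ y ≤ δ ^ 2 / 2

/-- In terms of the exact solution of the subproblem. -/
theorem isInexactStep_iff_of_isExactStep {n : ℕ} {f : Vec n → ℝ} {D : Set (Vec n)}
    {g : Vec n → EReal} {t δ : ℝ} {x₀ xbar xp : Vec n} (h : IsExactStep f D g t x₀ xbar) :
    IsInexactStep f D g t δ x₀ xp ↔
      xp ∈ domF D g ∧ model f g t x₀ xp - model f g t x₀ xbar ≤ δ ^ 2 / 2 := by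
  refine ⟨fun hx => ⟨hx.1, hx.2 xbar h.1⟩, fun hx => ⟨hx.1, fun y hy => ?_⟩⟩
  have h1 := h.2 y hy
  linarith [hx.2]

/-- The quadratic convergence region `{x ∈ dom F : ‖x - x*_t‖_{x*_t} ≤ β}` around the exact
solution `xs = x*_t`. -/
def quadRegion {n : ℕ} (f : Vec n → ℝ) (D : Set (Vec n)) (g : Vec n → EReal) (xs : Vec n)
    (β : ℝ) : Set (Vec n) :=
  {x | x ∈ domF D g ∧ localNorm f xs (x - xs) ≤ β}

end ProxNewton

/-!
For a self-concordant `f`, the bound on the third derivative along lines extends to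
`|D³f(x)[h, u, u]| ≤ 2 ‖h‖_x ‖u‖_x²`: restricted to the plane of `h` and `u`, this is an inequality
for binary cubic forms, proved by evaluating at a trisected angle. Integrating along a segment
with `r = ‖y - x‖_x < 1` gives `(1 - r)² ∇²f(x) ≼ ∇²f(y) ≼ (1 - r)⁻² ∇²f(x)`, and then
`‖∇f(y) - ∇f(x) - ∇²f(x)(y - x)‖_x^* ≤ r² / (1 - r)`. Comparing the optimality condition of `F` at
`x*` with the approximate optimality of the model along the segment from the new iterate to `x*`,
the step from `x` ends within `r² / (1 - r) + δ` of `x*` in the norm `‖·‖_x`, where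
`r = ‖x* - x‖_x`. Changing norms gives the quadratic error bound at `x*`. The condition on `Δ`
makes `β / (1 - Δ) + Δ ≤ √β / 2.581`, so the step starts in a region where that bound is at most
`β`.
-/

namespace ProxNewton

open Real Set Filter Topology

section Forms

theorem exists_trisection_mul_cos_add_mul_sin_nonneg (α p q : ℝ) :
    ∃ θ : ℝ, cos (3 * θ) = cos α ∧ sin (3 * θ) = sin α ∧ 0 ≤ p * cos θ + q * sin θ := by
  have hcos : cos (2 * π / 3) = -1 / 2 := by
    rw [show 2 * π / 3 = π - π / 3 by ring, cos_pi_sub, cos_pi_div_three]; ring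
  have hsum : (p * cos (α / 3) + q * sin (α / 3))
      + (p * cos (α / 3 + 2 * π / 3) + q * sin (α / 3 + 2 * π / 3))
      + (p * cos (α / 3 - 2 * π / 3) + q * sin (α / 3 - 2 * π / 3)) = 0 := by
    rw [cos_add, cos_sub, sin_add, sin_sub, hcos]; ring
  by_cases h₀ : 0 ≤ p * cos (α / 3) + q * sin (α / 3)
  · exact ⟨α / 3, by rw [mul_div_cancel₀ _ three_ne_zero], by
      rw [mul_div_cancel₀ _ three_ne_zero], h₀⟩
  by_cases h₁ : 0 ≤ p * cos (α / 3 + 2 * π / 3) + q * sin (α / 3 + 2 * π / 3)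
  · have hθ : 3 * (α / 3 + 2 * π / 3) = α + 2 * π := by ring
    exact ⟨α / 3 + 2 * π / 3, by rw [hθ, cos_add_two_pi], by rw [hθ, sin_add_two_pi], h₁⟩
  · have hθ : 3 * (α / 3 - 2 * π / 3) = α - 2 * π := by ring
    exact ⟨α / 3 - 2 * π / 3, by rw [hθ, cos_sub_two_pi], by rw [hθ, sin_sub_two_pi], by linarith⟩

theorem sq_add_sq_le_one_of_cubic_le_one {a b c d : ℝ}
    (h : ∀ X Y : ℝ, X ^ 2 + Y ^ 2 = 1 →
      a * X ^ 3 + 3 * b * X ^ 2 * Y + 3 * c * X * Y ^ 2 + d * Y ^ 3 ≤ 1) :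
    a ^ 2 + b ^ 2 ≤ 1 := by
  set z : ℂ := ⟨a, b⟩
  have ha : ‖z‖ * cos z.arg = a := Complex.norm_mul_cos_arg z
  have hb : ‖z‖ * sin z.arg = b := Complex.norm_mul_sin_arg z
  obtain ⟨θ, hcos, hsin, hnonneg⟩ :=
    exists_trisection_mul_cos_add_mul_sin_nonneg z.arg (3 * (c + a)) (d + b)
  have htrig := cos_sq_add_sin_sq θ
  -- The cubic is `re (conj z * (X + Y i) ^ 3)` plus `Y ^ 2` times a linear form.
  have hsplit : a * cos θ ^ 3 + 3 * b * cos θ ^ 2 * sin θ + 3 * c * cos θ * sin θ ^ 2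
        + d * sin θ ^ 3
      = (a * cos (3 * θ) + b * sin (3 * θ))
        + sin θ ^ 2 * (3 * (c + a) * cos θ + (d + b) * sin θ) := by
    rw [cos_three_mul, sin_three_mul]
    linear_combination (3 * b * sin θ - 3 * a * cos θ) * htrig
  have hnorm : a * cos (3 * θ) + b * sin (3 * θ) = ‖z‖ := by
    rw [hcos, hsin, ← ha, ← hb]
    linear_combination ‖z‖ * cos_sq_add_sin_sq z.arg
  have hz : ‖z‖ ≤ 1 := by
    have := h (cos θ) (sin θ) htrig
    have := mul_nonneg (sq_nonneg (sin θ)) hnonneg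
    linarith
  calc a ^ 2 + b ^ 2 = ‖z‖ ^ 2 := by
        rw [← ha, ← hb]; linear_combination ‖z‖ ^ 2 * cos_sq_add_sin_sq z.arg
    _ ≤ 1 := pow_le_one₀ (norm_nonneg z) hz

section Normed

variable {E : Type*} [NormedAddCommGroup E] [NormedSpace ℝ E]
  {H : E →L[ℝ] E →L[ℝ] ℝ} {T : E →L[ℝ] E →L[ℝ] E →L[ℝ] ℝ}

theorem exists_orthogonal_decomposition (Hsymm : ∀ u v, H u v = H v u)
    (Hpos : ∀ u, u ≠ 0 → 0 < H u u) {e : E} (he : H e e = 1) (h : E) :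
    ∃ (α κ : ℝ) (e' : E), H e e' = 0 ∧ H e' e' ≤ 1 ∧ h = α • e + κ • e' ∧
      H h h = α ^ 2 + κ ^ 2 := by
  obtain ⟨w, hw⟩ : ∃ w, h = H h e • e + w := ⟨h - H h e • e, by abel⟩
  set α := H h e
  have hwe : H w e = 0 := by
    have : α = α * H e e + H w e := by
      conv_lhs => rw [show α = H h e from rfl, hw]
      simp
    rw [he] at this
    linarith
  have hhw : H h h = α ^ 2 + H w w := by
    rw [hw]
    simp only [map_add, map_smul, add_apply, smul_apply, smul_eq_mul, Hsymm e w, hwe, he]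
    ring
  rcases eq_or_ne w 0 with rfl | hw0
  · exact ⟨α, 0, 0, by simp, by simp, by simpa using hw, by simpa using hhw⟩
  · have hκ : √(H w w) ≠ 0 := (sqrt_pos.2 (Hpos w hw0)).ne'
    have hκsq : √(H w w) ^ 2 = H w w := sq_sqrt (Hpos w hw0).le
    refine ⟨α, √(H w w), (√(H w w))⁻¹ • w, ?_, ?_, ?_, by rw [hhw, hκsq]⟩
    · simp [Hsymm e w, hwe]
    · simp only [map_smul, smul_apply, smul_eq_mul]
      nth_rewrite 3 [← hκsq]
      exact le_of_eq (by field_simp)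
    · rw [smul_inv_smul₀ hκ, ← hw]

theorem trilinear_apply_unit_le (Hsymm : ∀ u v, H u v = H v u) (Hpos : ∀ u, u ≠ 0 → 0 < H u u)
    (T12 : ∀ u v w, T u v w = T v u w) (T23 : ∀ u v w, T u v w = T u w v)
    (hT : ∀ u, |T u u u| ≤ 2 * √(H u u) ^ 3) {e : E} (he : H e e = 1) (h : E) :
    T h e e ≤ 2 * √(H h h) := by
  obtain ⟨α, κ, e', hee', he', rfl, hh⟩ := exists_orthogonal_decomposition Hsymm Hpos he h
  have hcubic : (T e e e / 2) ^ 2 + (T e' e e / 2) ^ 2 ≤ 1 := by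
    refine sq_add_sq_le_one_of_cubic_le_one (c := T e' e' e / 2) (d := T e' e' e' / 2)
      fun X Y hXY => ?_
    have hunit : H (X • e + Y • e') (X • e + Y • e') ≤ 1 := by
      simp only [map_add, map_smul, add_apply, smul_apply, smul_eq_mul, he, hee',
        Hsymm e' e]
      nlinarith [mul_le_mul_of_nonneg_left he' (sq_nonneg Y)]
    have hle : T (X • e + Y • e') (X • e + Y • e') (X • e + Y • e') ≤ 2 :=
      calc _ ≤ 2 * √(H (X • e + Y • e') (X • e + Y • e')) ^ 3 := (le_abs_self _).trans (hT _)
        _ ≤ 2 * 1 ^ 3 := by gcongr; exact sqrt_le_one.2 hunit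
        _ = 2 := by norm_num
    simp only [map_add, map_smul, add_apply, smul_apply, smul_eq_mul] at hle
    rw [T23 e e e', T12 e e' e, T23 e e' e', T12 e e' e', T23 e' e e'] at hle
    linarith
  have hcauchy : α * (T e e e / 2) + κ * (T e' e e / 2) ≤ √(α ^ 2 + κ ^ 2) := by
    refine le_sqrt_of_sq_le ?_
    nlinarith [sq_nonneg (α * (T e' e e / 2) - κ * (T e e e / 2)),
      mul_le_mul_of_nonneg_left hcubic (by positivity : 0 ≤ α ^ 2 + κ ^ 2)]
  rw [hh]
  simp only [map_add, map_smul, add_apply, smul_apply, smul_eq_mul]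
  linarith

theorem trilinear_le_of_posDef (Hsymm : ∀ u v, H u v = H v u)
    (Hpos : ∀ u, u ≠ 0 → 0 < H u u)
    (T12 : ∀ u v w, T u v w = T v u w) (T23 : ∀ u v w, T u v w = T u w v)
    (hT : ∀ u, |T u u u| ≤ 2 * √(H u u) ^ 3) (h u : E) :
    T h u u ≤ 2 * √(H h h) * H u u := by
  rcases eq_or_ne u 0 with rfl | hu
  · simp
  set N := √(H u u)
  have hN : N ≠ 0 := (sqrt_pos.2 (Hpos u hu)).ne'
  have hNsq : H u u = N ^ 2 := (sq_sqrt (Hpos u hu).le).symm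
  have hunit : H (N⁻¹ • u) (N⁻¹ • u) = 1 := by
    simp only [map_smul, smul_apply, smul_eq_mul, hNsq]
    field_simp
  have hle := trilinear_apply_unit_le Hsymm Hpos T12 T23 hT hunit h
  calc T h u u = N ^ 2 * T h (N⁻¹ • u) (N⁻¹ • u) := by
        simp only [map_smul, smul_apply, smul_eq_mul]
        field_simp
    _ ≤ N ^ 2 * (2 * √(H h h)) := by gcongr
    _ = 2 * √(H h h) * H u u := by rw [hNsq]; ring

theorem abs_apply_le_of_abs_apply_self_le {B : E →L[ℝ] E →L[ℝ] ℝ} {κ : ℝ} (hκ : 0 ≤ κ)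
    (Hnonneg : ∀ u, 0 ≤ H u u) (Bsymm : ∀ u v, B u v = B v u)
    (hB : ∀ u, |B u u| ≤ κ * H u u) (u v : E) :
    |B u v| ≤ κ * √(H u u) * √(H v v) := by
  -- Polarization: `4 s B(u, v) = B(su + v, su + v) - B(su - v, su - v)`.
  have hquad (s : ℝ) : 0 ≤ κ * H u u * (s * s) + -(2 * B u v) * s + κ * H v v := by
    have hadd := (abs_le.1 (hB (s • u + v))).2
    have hsub := (abs_le.1 (hB (s • u - v))).1
    simp only [map_add, map_sub, map_smul, add_apply, sub_apply, smul_apply, smul_eq_mul,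
      Bsymm v u] at hadd hsub
    linarith
  have hdiscrim := discrim_le_zero hquad
  refine abs_le_of_sq_le_sq ?_ (by positivity)
  rw [mul_pow, mul_pow, sq_sqrt (Hnonneg u), sq_sqrt (Hnonneg v)]
  rw [discrim] at hdiscrim
  linarith

theorem sqrt_apply_add_le (Hsymm : ∀ u v, H u v = H v u) (Hnonneg : ∀ u, 0 ≤ H u u) (u v : E) :
    √(H (u + v) (u + v)) ≤ √(H u u) + √(H v v) := by
  have hcauchy : |H u v| ≤ 1 * √(H u u) * √(H v v) :=
    abs_apply_le_of_abs_apply_self_le zero_le_one Hnonneg Hsymm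
      (fun u => by rw [abs_of_nonneg (Hnonneg u), one_mul]) u v
  refine sqrt_le_iff.2 ⟨by positivity, ?_⟩
  simp only [map_add, add_apply, Hsymm v u]
  linarith [le_abs_self (H u v), sq_sqrt (Hnonneg u), sq_sqrt (Hnonneg v),
    add_sq (√(H u u)) (√(H v v))]

end Normed

theorem abs_trilinear_le_of_abs_apply_self_le {E : Type*} [NormedAddCommGroup E]
    [InnerProductSpace ℝ E] {H : E →L[ℝ] E →L[ℝ] ℝ} {T : E →L[ℝ] E →L[ℝ] E →L[ℝ] ℝ}
    (Hsymm : ∀ u v, H u v = H v u) (Hnonneg : ∀ u, 0 ≤ H u u)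
    (T12 : ∀ u v w, T u v w = T v u w) (T23 : ∀ u v w, T u v w = T u w v)
    (hT : ∀ u, |T u u u| ≤ 2 * √(H u u) ^ 3) (h u : E) :
    |T h u u| ≤ 2 * √(H h h) * H u u := by
  have hupper (h : E) : T h u u ≤ 2 * √(H h h) * H u u := by
    -- Perturb `H` to the positive definite form `H + ε ⟪·, ·⟫` and let `ε → 0`.
    have hε {ε : ℝ} (hε : 0 < ε) : T h u u ≤
        2 * √(H h h + ε * ‖h‖ ^ 2) * (H u u + ε * ‖u‖ ^ 2) := by
      let I : E →L[ℝ] E →L[ℝ] ℝ := innerSL ℝ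
      let Hε : E →L[ℝ] E →L[ℝ] ℝ := H + ε • I
      have happly (v w : E) : Hε v w = H v w + ε * inner ℝ v w := rfl
      have hle := trilinear_le_of_posDef (H := Hε) (T := T)
        (fun v w => by rw [happly, happly, Hsymm, real_inner_comm])
        (fun v hv => by
          rw [happly, real_inner_self_eq_norm_sq]
          have := Hnonneg v
          positivity)
        T12 T23
        (fun v => (hT v).trans (by
          rw [happly, real_inner_self_eq_norm_sq]
          gcongr
          exact le_add_of_nonneg_right (by positivity))) h u
      simpa only [happly, real_inner_self_eq_norm_sq] using hle
    have hlim : Tendsto (fun ε : ℝ => 2 * √(H h h + ε * ‖h‖ ^ 2) * (H u u + ε * ‖u‖ ^ 2))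
        (𝓝[>] 0) (𝓝 (2 * √(H h h + 0 * ‖h‖ ^ 2) * (H u u + 0 * ‖u‖ ^ 2))) :=
      (Continuous.tendsto (by fun_prop) 0).mono_left nhdsWithin_le_nhds
    simpa using ge_of_tendsto hlim (eventually_mem_nhdsWithin.mono fun ε hpos => hε hpos)
  refine abs_le'.2 ⟨hupper h, ?_⟩
  simpa using hupper (-h)

end Forms

section LineCalculus

variable {E F : Type*} [NormedAddCommGroup E] [NormedSpace ℝ E]
  [NormedAddCommGroup F] [NormedSpace ℝ F]

theorem hasDerivAt_comp_line {G : E → F} {x h : E} {τ : ℝ}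
    (hG : DifferentiableAt ℝ G (x + τ • h)) :
    HasDerivAt (fun s : ℝ => G (x + s • h)) (fderiv ℝ G (x + τ • h) h) τ := by
  have hline : HasDerivAt (fun s : ℝ => x + s • h) h τ := by
    simpa using ((hasDerivAt_id τ).smul_const h).const_add x
  exact hG.hasFDerivAt.comp_hasDerivAt τ hline

theorem hasDerivAt_comp_line_apply {G : E → E →L[ℝ] F} {x h : E} {τ : ℝ}
    (hG : DifferentiableAt ℝ G (x + τ • h)) (u : E) :
    HasDerivAt (fun s : ℝ => G (x + s • h) u) (fderiv ℝ G (x + τ • h) h u) τ := by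
  simpa using (hasDerivAt_comp_line hG).clm_apply (hasDerivAt_const τ u)

theorem hasDerivAt_comp_line_apply_apply {G : E → E →L[ℝ] E →L[ℝ] F} {x h : E} {τ : ℝ}
    (hG : DifferentiableAt ℝ G (x + τ • h)) (u v : E) :
    HasDerivAt (fun s : ℝ => G (x + s • h) u v) (fderiv ℝ G (x + τ • h) h u v) τ := by
  simpa using (hasDerivAt_comp_line_apply hG u).clm_apply (hasDerivAt_const τ v)

theorem isOpen_preimage_line {D : Set E} (hD : IsOpen D) (x h : E) :
    IsOpen {τ : ℝ | x + τ • h ∈ D} :=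
  hD.preimage (f := fun τ : ℝ => x + τ • h) (by fun_prop)

variable {f : E → ℝ} {D : Set E} {x : E}

theorem contDiffAt_fderiv (hD : IsOpen D) (hf : ContDiffOn ℝ 3 f D) (hx : x ∈ D) :
    ContDiffAt ℝ 2 (fderiv ℝ f) x :=
  (hf.contDiffAt (hD.mem_nhds hx)).fderiv_right (by norm_num)

theorem differentiableAt_fderiv (hD : IsOpen D) (hf : ContDiffOn ℝ 3 f D) (hx : x ∈ D) :
    DifferentiableAt ℝ (fderiv ℝ f) x :=
  (contDiffAt_fderiv hD hf hx).differentiableAt two_ne_zero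

theorem differentiableAt_fderiv_fderiv (hD : IsOpen D) (hf : ContDiffOn ℝ 3 f D) (hx : x ∈ D) :
    DifferentiableAt ℝ (fderiv ℝ (fderiv ℝ f)) x :=
  ((contDiffAt_fderiv hD hf hx).fderiv_right (m := 1) (by norm_num)).differentiableAt one_ne_zero

theorem isSymmSndFDerivAt_of_contDiffOn (hD : IsOpen D) (hf : ContDiffOn ℝ 3 f D) (hx : x ∈ D) :
    IsSymmSndFDerivAt ℝ f x :=
  (hf.contDiffAt (hD.mem_nhds hx)).isSymmSndFDerivAt (by simp; norm_num)

theorem third_fderiv_swap_left (hD : IsOpen D) (hf : ContDiffOn ℝ 3 f D) (hx : x ∈ D)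
    (u v w : E) : fderiv ℝ (fderiv ℝ (fderiv ℝ f)) x u v w =
      fderiv ℝ (fderiv ℝ (fderiv ℝ f)) x v u w :=
  DFunLike.congr_fun ((contDiffAt_fderiv hD hf hx).isSymmSndFDerivAt (by simp) u v) w

theorem third_fderiv_swap_right (hD : IsOpen D) (hf : ContDiffOn ℝ 3 f D) (hx : x ∈ D)
    (u v w : E) : fderiv ℝ (fderiv ℝ (fderiv ℝ f)) x u v w =
      fderiv ℝ (fderiv ℝ (fderiv ℝ f)) x u w v := by
  have hx0 : x + (0 : ℝ) • u ∈ D := by simpa using hx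
  have hderiv := hasDerivAt_comp_line_apply_apply (differentiableAt_fderiv_fderiv hD hf hx0)
  have hswap : (fun τ : ℝ => fderiv ℝ (fderiv ℝ f) (x + τ • u) v w) =ᶠ[𝓝 0]
      fun τ => fderiv ℝ (fderiv ℝ f) (x + τ • u) w v := by
    filter_upwards [(isOpen_preimage_line hD x u).mem_nhds hx0] with τ hτ
    exact isSymmSndFDerivAt_of_contDiffOn hD hf hτ v w
  simpa using (hderiv v w).unique ((hderiv w v).congr_of_eventuallyEq hswap)

theorem deriv_comp_line_eqOn (hD : IsOpen D) (hf : ContDiffOn ℝ 3 f D) (x u : E) :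
    EqOn (deriv fun τ : ℝ => f (x + τ • u)) (fun τ => fderiv ℝ f (x + τ • u) u)
      {τ | x + τ • u ∈ D} := fun _ hτ =>
  (hasDerivAt_comp_line
    ((hf.contDiffAt (hD.mem_nhds hτ)).differentiableAt three_ne_zero)).deriv

theorem iteratedDeriv_two_comp_line_eqOn (hD : IsOpen D) (hf : ContDiffOn ℝ 3 f D) (x u : E) :
    EqOn (iteratedDeriv 2 fun τ : ℝ => f (x + τ • u))
      (fun τ => fderiv ℝ (fderiv ℝ f) (x + τ • u) u u) {τ | x + τ • u ∈ D} := by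
  intro τ hτ
  rw [iteratedDeriv_succ, iteratedDeriv_one, ((deriv_comp_line_eqOn hD hf x u).eventuallyEq_of_mem
    ((isOpen_preimage_line hD x u).mem_nhds hτ)).deriv_eq]
  exact (hasDerivAt_comp_line_apply (differentiableAt_fderiv hD hf hτ) u).deriv

theorem iteratedDeriv_three_comp_line_eqOn (hD : IsOpen D) (hf : ContDiffOn ℝ 3 f D) (x u : E) :
    EqOn (iteratedDeriv 3 fun τ : ℝ => f (x + τ • u))
      (fun τ => fderiv ℝ (fderiv ℝ (fderiv ℝ f)) (x + τ • u) u u u) {τ | x + τ • u ∈ D} := by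
  intro τ hτ
  rw [iteratedDeriv_succ, ((iteratedDeriv_two_comp_line_eqOn hD hf x u).eventuallyEq_of_mem
    ((isOpen_preimage_line hD x u).mem_nhds hτ)).deriv_eq]
  exact (hasDerivAt_comp_line_apply_apply (differentiableAt_fderiv_fderiv hD hf hτ) u u).deriv

theorem fderiv_fderiv_apply_self_nonneg (hD : IsOpen D) (hf : ContDiffOn ℝ 3 f D)
    (hconv : ConvexOn ℝ D f) (hx : x ∈ D) (u : E) : 0 ≤ fderiv ℝ (fderiv ℝ f) x u u := by
  set I : Set ℝ := {τ | x + τ • u ∈ D}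
  have hI : IsOpen I := isOpen_preimage_line hD x u
  have h0 : (0 : ℝ) ∈ I := by simpa [I] using hx
  have hconvLine : ConvexOn ℝ I fun τ : ℝ => f (x + τ • u) := by
    have hline := hconv.comp_affineMap (AffineMap.lineMap x (x + u) : ℝ →ᵃ[ℝ] E)
    simpa [AffineMap.lineMap_apply, Function.comp_def, preimage, I, add_comm] using hline
  have hmono : MonotoneOn (deriv fun τ : ℝ => f (x + τ • u)) I :=
    hconvLine.monotoneOn_deriv fun τ hτ => (hasDerivAt_comp_line
      ((hf.contDiffAt (hD.mem_nhds hτ)).differentiableAt three_ne_zero)).differentiableAt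
  have hnonneg := hmono.derivWithin_nonneg (x := 0)
  rw [derivWithin_of_isOpen hI h0] at hnonneg
  have h2 := iteratedDeriv_two_comp_line_eqOn hD hf x u h0
  rw [iteratedDeriv_succ, iteratedDeriv_one] at h2
  simpa [h2] using hnonneg

end LineCalculus

section DifferentialInequalities

variable {q q' : ℝ → ℝ}

theorem sqrt_mul_one_sub_le_of_deriv_le_of_pos (hpos : ∀ s ∈ Icc (0 : ℝ) 1, 0 < q s)
    (hq : ∀ s ∈ Icc (0 : ℝ) 1, HasDerivAt q (q' s) s)
    (hq' : ∀ s ∈ Icc (0 : ℝ) 1, q' s ≤ 2 * √(q s) ^ 3) {τ : ℝ} (hτ : τ ∈ Icc (0 : ℝ) 1) :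
    √(q τ) * (1 - √(q 0) * τ) ≤ √(q 0) := by
  have hderiv (s : ℝ) (hs : s ∈ Icc (0 : ℝ) 1) : HasDerivAt (fun s => (√(q s))⁻¹ + s)
      (-(q' s / (2 * √(q s))) / √(q s) ^ 2 + 1) s :=
    (((hq s hs).sqrt (hpos s hs).ne').fun_inv (sqrt_pos.2 (hpos s hs)).ne').add (hasDerivAt_id s)
  have hmono : MonotoneOn (fun s => (√(q s))⁻¹ + s) (Icc 0 1) := by
    refine monotoneOn_of_hasDerivWithinAt_nonneg (convex_Icc 0 1)
      (fun s hs => (hderiv s hs).continuousAt.continuousWithinAt)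
      (fun s hs => (hderiv s (interior_subset hs)).hasDerivWithinAt) fun s hs => ?_
    have hs := interior_subset hs
    have hsqrt : 0 < √(q s) := sqrt_pos.2 (hpos s hs)
    have hle : q' s / (2 * √(q s)) / √(q s) ^ 2 ≤ 1 := by
      rw [div_div, div_le_one (by positivity)]
      linarith [hq' s hs]
    rw [neg_div]
    linarith
  have hτ0 : 0 < √(q τ) := sqrt_pos.2 (hpos τ hτ)
  have h00 : 0 < √(q 0) := sqrt_pos.2 (hpos 0 (by simp))
  have hle : (√(q 0))⁻¹ ≤ (√(q τ))⁻¹ + τ := by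
    simpa using hmono (left_mem_Icc.2 zero_le_one) hτ hτ.1
  calc √(q τ) * (1 - √(q 0) * τ) = √(q τ) * √(q 0) * ((√(q 0))⁻¹ - τ) := by field_simp
    _ ≤ √(q τ) * √(q 0) * (√(q τ))⁻¹ := by gcongr; linarith
    _ = √(q 0) := by field_simp

theorem sqrt_mul_one_sub_le_of_deriv_le (hnonneg : ∀ s ∈ Icc (0 : ℝ) 1, 0 ≤ q s)
    (hq : ∀ s ∈ Icc (0 : ℝ) 1, HasDerivAt q (q' s) s)
    (hq' : ∀ s ∈ Icc (0 : ℝ) 1, q' s ≤ 2 * √(q s) ^ 3) {τ : ℝ} (hτ : τ ∈ Icc (0 : ℝ) 1) :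
    √(q τ) * (1 - √(q 0) * τ) ≤ √(q 0) := by
  -- `q + ε` satisfies the same differential inequality and is positive; let `ε → 0`.
  have hε {ε : ℝ} (hε : 0 < ε) : 0 ≤ √(q 0 + ε) - √(q τ + ε) * (1 - √(q 0 + ε) * τ) :=
    sub_nonneg.2 <| sqrt_mul_one_sub_le_of_deriv_le_of_pos (q := fun s => q s + ε)
      (fun s hs => add_pos_of_nonneg_of_pos (hnonneg s hs) hε) (fun s hs => (hq s hs).add_const ε)
      (fun s hs => (hq' s hs).trans (by gcongr; linarith)) hτ
  have hlim : Tendsto (fun ε => √(q 0 + ε) - √(q τ + ε) * (1 - √(q 0 + ε) * τ)) (𝓝[>] 0)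
      (𝓝 (√(q 0 + 0) - √(q τ + 0) * (1 - √(q 0 + 0) * τ))) :=
    (Continuous.tendsto (by fun_prop) 0).mono_left nhdsWithin_le_nhds
  simpa using ge_of_tendsto hlim (eventually_mem_nhdsWithin.mono fun ε hpos => hε hpos)

variable {r : ℝ}

theorem mul_one_sub_sq_le_of_deriv_le (hr : ∀ s ∈ Icc (0 : ℝ) 1, 0 ≤ 1 - r * s)
    (hq : ∀ s ∈ Icc (0 : ℝ) 1, HasDerivAt q (q' s) s)
    (hq' : ∀ s ∈ Icc (0 : ℝ) 1, q' s * (1 - r * s) ≤ 2 * r * q s)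
    {τ : ℝ} (hτ : τ ∈ Icc (0 : ℝ) 1) : q τ * (1 - r * τ) ^ 2 ≤ q 0 := by
  have hderiv (s : ℝ) (hs : s ∈ Icc (0 : ℝ) 1) : HasDerivAt (fun s => q s * (1 - r * s) ^ 2)
      ((q' s * (1 - r * s) - 2 * r * q s) * (1 - r * s)) s := by
    have hlin : HasDerivAt (fun s : ℝ => 1 - r * s) (-r) s := by
      simpa using ((hasDerivAt_id s).const_mul r).const_sub 1
    exact ((hq s hs).mul (hlin.fun_pow 2)).congr_deriv (by norm_num; ring)
  have hanti : AntitoneOn (fun s => q s * (1 - r * s) ^ 2) (Icc 0 1) :=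
    antitoneOn_of_hasDerivWithinAt_nonpos (convex_Icc 0 1)
      (fun s hs => (hderiv s hs).continuousAt.continuousWithinAt)
      (fun s hs => (hderiv s (interior_subset hs)).hasDerivWithinAt) fun s hs =>
        mul_nonpos_of_nonpos_of_nonneg (sub_nonpos.2 (hq' s (interior_subset hs)))
          (hr s (interior_subset hs))
  simpa using hanti (left_mem_Icc.2 zero_le_one) hτ hτ.1

theorem mul_one_sub_sq_le_of_le_deriv (hr : ∀ s ∈ Icc (0 : ℝ) 1, 0 < 1 - r * s)
    (hq : ∀ s ∈ Icc (0 : ℝ) 1, HasDerivAt q (q' s) s)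
    (hq' : ∀ s ∈ Icc (0 : ℝ) 1, -(2 * r * q s) ≤ q' s * (1 - r * s))
    {τ : ℝ} (hτ : τ ∈ Icc (0 : ℝ) 1) : q 0 * (1 - r * τ) ^ 2 ≤ q τ := by
  have hderiv (s : ℝ) (hs : s ∈ Icc (0 : ℝ) 1) : HasDerivAt (fun s => q s / (1 - r * s) ^ 2)
      ((q' s * (1 - r * s) + 2 * r * q s) / (1 - r * s) ^ 3) s := by
    have hlin : HasDerivAt (fun s : ℝ => 1 - r * s) (-r) s := by
      simpa using ((hasDerivAt_id s).const_mul r).const_sub 1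
    have hne := (hr s hs).ne'
    exact ((hq s hs).div (hlin.fun_pow 2) (pow_ne_zero 2 hne)).congr_deriv (by
      norm_num
      field_simp)
  have hmono : MonotoneOn (fun s => q s / (1 - r * s) ^ 2) (Icc 0 1) :=
    monotoneOn_of_hasDerivWithinAt_nonneg (convex_Icc 0 1)
      (fun s hs => (hderiv s hs).continuousAt.continuousWithinAt)
      (fun s hs => (hderiv s (interior_subset hs)).hasDerivWithinAt) fun s hs =>
        div_nonneg (by linarith [hq' s (interior_subset hs)])
          (pow_nonneg (hr s (interior_subset hs)).le 3)
  have hle : q 0 ≤ q τ / (1 - r * τ) ^ 2 := by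
    simpa using hmono (left_mem_Icc.2 zero_le_one) hτ hτ.1
  rwa [le_div_iff₀ (pow_pos (hr τ hτ) 2)] at hle

end DifferentialInequalities

section SelfConcordant

variable {n : ℕ} {f : Vec n → ℝ} {D : Set (Vec n)} {x y h : Vec n}

theorem localNorm_nonneg (f : Vec n → ℝ) (x u : Vec n) : 0 ≤ localNorm f x u :=
  sqrt_nonneg _

theorem localNorm_sub_comm (f : Vec n → ℝ) (x u v : Vec n) :
    localNorm f x (u - v) = localNorm f x (v - u) := by
  rw [localNorm, localNorm, ← neg_sub v u]
  simp only [hess, map_neg, neg_apply, neg_neg]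

theorem one_sub_localNorm_mul_pos (hr : localNorm f x h < 1) {s : ℝ} (hs : s ∈ Icc (0 : ℝ) 1) :
    0 < 1 - localNorm f x h * s :=
  sub_pos.2 ((mul_le_of_le_one_right (localNorm_nonneg f x h) hs.2).trans_lt hr)

namespace IsSelfConcordant

theorem hess_self_nonneg (hf : IsSelfConcordant f D) (hx : x ∈ D) (u : Vec n) :
    0 ≤ hess f x u u :=
  fderiv_fderiv_apply_self_nonneg hf.isOpen_dom hf.contDiffOn hf.convexOn hx u

theorem localNorm_sq (hf : IsSelfConcordant f D) (hx : x ∈ D) (u : Vec n) :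
    localNorm f x u ^ 2 = hess f x u u :=
  sq_sqrt (hf.hess_self_nonneg hx u)

theorem hess_comm (hf : IsSelfConcordant f D) (hx : x ∈ D) (u v : Vec n) :
    hess f x u v = hess f x v u :=
  isSymmSndFDerivAt_of_contDiffOn hf.isOpen_dom hf.contDiffOn hx u v

theorem localNorm_add_le (hf : IsSelfConcordant f D) (hx : x ∈ D) (u v : Vec n) :
    localNorm f x (u + v) ≤ localNorm f x u + localNorm f x v :=
  sqrt_apply_add_le (hf.hess_comm hx) (hf.hess_self_nonneg hx) u v

theorem abs_third_fderiv_self_le (hf : IsSelfConcordant f D) (hx : x ∈ D) (u : Vec n) :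
    |fderiv ℝ (fderiv ℝ (fderiv ℝ f)) x u u u| ≤ 2 * localNorm f x u ^ 3 := by
  have hx0 : x + (0 : ℝ) • u ∈ D := by simpa using hx
  have hline := (hf.line x hx u).2 0 hx0
  rw [iteratedDeriv_two_comp_line_eqOn hf.isOpen_dom hf.contDiffOn x u hx0,
    iteratedDeriv_three_comp_line_eqOn hf.isOpen_dom hf.contDiffOn x u hx0] at hline
  simp only [zero_smul, add_zero] at hline
  have hpow : localNorm f x u ^ 3 = hess f x u u ^ ((3 : ℝ) / 2) := by
    rw [localNorm, sqrt_eq_rpow, ← rpow_natCast, ← rpow_mul (hf.hess_self_nonneg hx u)]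
    norm_num
  rwa [hpow]

theorem abs_third_fderiv_le (hf : IsSelfConcordant f D) (hx : x ∈ D) (h u : Vec n) :
    |fderiv ℝ (fderiv ℝ (fderiv ℝ f)) x h u u| ≤ 2 * localNorm f x h * hess f x u u :=
  abs_trilinear_le_of_abs_apply_self_le (hf.hess_comm hx) (hf.hess_self_nonneg hx)
    (third_fderiv_swap_left hf.isOpen_dom hf.contDiffOn hx)
    (third_fderiv_swap_right hf.isOpen_dom hf.contDiffOn hx)
    (hf.abs_third_fderiv_self_le hx) h u

theorem hasDerivAt_hess_comp_line (hf : IsSelfConcordant f D) {τ : ℝ} (hτ : x + τ • h ∈ D)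
    (u v : Vec n) : HasDerivAt (fun s : ℝ => hess f (x + s • h) u v)
      (fderiv ℝ (fderiv ℝ (fderiv ℝ f)) (x + τ • h) h u v) τ :=
  hasDerivAt_comp_line_apply_apply
    (differentiableAt_fderiv_fderiv hf.isOpen_dom hf.contDiffOn hτ) u v

theorem localNorm_segment_mul_le (hf : IsSelfConcordant f D)
    (hseg : ∀ s ∈ Icc (0 : ℝ) 1, x + s • h ∈ D) {τ : ℝ} (hτ : τ ∈ Icc (0 : ℝ) 1) :
    localNorm f (x + τ • h) h * (1 - localNorm f x h * τ) ≤ localNorm f x h := by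
  have hle := sqrt_mul_one_sub_le_of_deriv_le (q := fun s => hess f (x + s • h) h h)
    (fun s hs => hf.hess_self_nonneg (hseg s hs) h)
    (fun s hs => hf.hasDerivAt_hess_comp_line (hseg s hs) h h)
    (fun s hs => (le_abs_self _).trans (hf.abs_third_fderiv_self_le (hseg s hs) h)) hτ
  simpa only [localNorm, zero_smul, add_zero] using hle

theorem abs_third_fderiv_segment_mul_le (hf : IsSelfConcordant f D)
    (hseg : ∀ s ∈ Icc (0 : ℝ) 1, x + s • h ∈ D) {τ : ℝ} (hτ : τ ∈ Icc (0 : ℝ) 1)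
    (hr : 0 ≤ 1 - localNorm f x h * τ) (u : Vec n) :
    |fderiv ℝ (fderiv ℝ (fderiv ℝ f)) (x + τ • h) h u u| * (1 - localNorm f x h * τ) ≤
      2 * localNorm f x h * hess f (x + τ • h) u u :=
  calc _ ≤ 2 * localNorm f (x + τ • h) h * hess f (x + τ • h) u u *
        (1 - localNorm f x h * τ) := by
        gcongr
        exact hf.abs_third_fderiv_le (hseg τ hτ) h u
    _ = 2 * (localNorm f (x + τ • h) h * (1 - localNorm f x h * τ)) *
        hess f (x + τ • h) u u := by ring
    _ ≤ 2 * localNorm f x h * hess f (x + τ • h) u u := by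
        gcongr
        · exact hf.hess_self_nonneg (hseg τ hτ) u
        · exact hf.localNorm_segment_mul_le hseg hτ

theorem hess_segment_mul_le (hf : IsSelfConcordant f D)
    (hseg : ∀ s ∈ Icc (0 : ℝ) 1, x + s • h ∈ D) (hr : localNorm f x h < 1) {τ : ℝ}
    (hτ : τ ∈ Icc (0 : ℝ) 1) (u : Vec n) :
    hess f (x + τ • h) u u * (1 - localNorm f x h * τ) ^ 2 ≤ hess f x u u := by
  have hpos {s : ℝ} (hs : s ∈ Icc (0 : ℝ) 1) := (one_sub_localNorm_mul_pos hr hs).le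
  have hle := mul_one_sub_sq_le_of_deriv_le (q := fun s => hess f (x + s • h) u u)
    (fun s hs => hpos hs) (fun s hs => hf.hasDerivAt_hess_comp_line (hseg s hs) u u)
    (fun s hs => (mul_le_mul_of_nonneg_right (le_abs_self _) (hpos hs)).trans
      (hf.abs_third_fderiv_segment_mul_le hseg hs (hpos hs) u)) hτ
  simpa only [zero_smul, add_zero] using hle

theorem mul_le_hess_segment (hf : IsSelfConcordant f D)
    (hseg : ∀ s ∈ Icc (0 : ℝ) 1, x + s • h ∈ D) (hr : localNorm f x h < 1) {τ : ℝ}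
    (hτ : τ ∈ Icc (0 : ℝ) 1) (u : Vec n) :
    hess f x u u * (1 - localNorm f x h * τ) ^ 2 ≤ hess f (x + τ • h) u u := by
  have hpos {s : ℝ} (hs : s ∈ Icc (0 : ℝ) 1) := one_sub_localNorm_mul_pos hr hs
  have hle := mul_one_sub_sq_le_of_le_deriv (q := fun s => hess f (x + s • h) u u)
    (fun s hs => hpos hs) (fun s hs => hf.hasDerivAt_hess_comp_line (hseg s hs) u u)
    (fun s hs => (neg_le_neg
      (hf.abs_third_fderiv_segment_mul_le hseg hs (hpos hs).le u)).trans (by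
        rw [← neg_mul]
        exact mul_le_mul_of_nonneg_right (neg_abs_le _) (hpos hs).le)) hτ
  simpa only [zero_smul, add_zero] using hle

theorem add_smul_sub_mem (hf : IsSelfConcordant f D) (hx : x ∈ D) (hy : y ∈ D) :
    ∀ s ∈ Icc (0 : ℝ) 1, x + s • (y - x) ∈ D := fun _ hs =>
  hf.convexOn.1.add_smul_sub_mem hx hy hs

theorem localNorm_mul_one_sub_le (hf : IsSelfConcordant f D) (hx : x ∈ D) (hy : y ∈ D)
    (hr : localNorm f x (y - x) < 1) (u : Vec n) :
    localNorm f y u * (1 - localNorm f x (y - x)) ≤ localNorm f x u := by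
  have hle := hf.hess_segment_mul_le (hf.add_smul_sub_mem hx hy) hr (right_mem_Icc.2 zero_le_one) u
  rw [one_smul, mul_one, add_sub_cancel, ← hf.localNorm_sq hx, ← hf.localNorm_sq hy,
    ← mul_pow] at hle
  exact le_of_sq_le_sq hle (localNorm_nonneg f x u)

theorem mul_one_sub_le_localNorm (hf : IsSelfConcordant f D) (hx : x ∈ D) (hy : y ∈ D)
    (hr : localNorm f x (y - x) < 1) (u : Vec n) :
    localNorm f x u * (1 - localNorm f x (y - x)) ≤ localNorm f y u := by
  have hle := hf.mul_le_hess_segment (hf.add_smul_sub_mem hx hy) hr (right_mem_Icc.2 zero_le_one) u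
  rw [one_smul, mul_one, add_sub_cancel, ← hf.localNorm_sq hx, ← hf.localNorm_sq hy,
    ← mul_pow] at hle
  exact le_of_sq_le_sq hle (localNorm_nonneg f y u)

theorem abs_hess_segment_sub_le (hf : IsSelfConcordant f D)
    (hseg : ∀ s ∈ Icc (0 : ℝ) 1, x + s • h ∈ D) (hr : localNorm f x h < 1) {τ : ℝ}
    (hτ : τ ∈ Icc (0 : ℝ) 1) (u v : Vec n) :
    |hess f (x + τ • h) u v - hess f x u v| ≤
      (((1 - localNorm f x h * τ) ^ 2)⁻¹ - 1) * localNorm f x u * localNorm f x v := by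
  have hx : x ∈ D := by simpa using hseg 0 (by simp)
  have hpos := one_sub_localNorm_mul_pos hr hτ
  set c := (1 - localNorm f x h * τ) ^ 2
  have hc : 0 < c := pow_pos hpos 2
  have hc1 : c ≤ 1 := pow_le_one₀ hpos.le
    (sub_le_self 1 (mul_nonneg (localNorm_nonneg f x h) hτ.1))
  refine abs_apply_le_of_abs_apply_self_le (H := fderiv ℝ (fderiv ℝ f) x)
    (B := fderiv ℝ (fderiv ℝ f) (x + τ • h) - fderiv ℝ (fderiv ℝ f) x)
    (sub_nonneg.2 (one_le_inv₀ hc |>.2 hc1)) (hf.hess_self_nonneg hx)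
    (fun u v => congr_arg₂ (· - ·) (hf.hess_comm (hseg τ hτ) u v) (hf.hess_comm hx u v))
    (fun u => ?_) u v
  change |hess f (x + τ • h) u u - hess f x u u| ≤ (c⁻¹ - 1) * hess f x u u
  have hupper : hess f (x + τ • h) u u ≤ c⁻¹ * hess f x u u := by
    rw [inv_mul_eq_div, le_div_iff₀ hc]
    exact hf.hess_segment_mul_le hseg hr hτ u
  have hlower : hess f x u u * c ≤ hess f (x + τ • h) u u := hf.mul_le_hess_segment hseg hr hτ u
  have hamgm : 0 ≤ c⁻¹ + c - 2 := by
    rw [show c⁻¹ + c - 2 = (1 - c) ^ 2 / c by field_simp; ring]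
    positivity
  exact abs_le.2 ⟨by linarith [mul_nonneg hamgm (hf.hess_self_nonneg hx u)], by linarith⟩

theorem abs_fderiv_sub_sub_hess_le (hf : IsSelfConcordant f D) (hx : x ∈ D) (hy : y ∈ D)
    (hr : localNorm f x (y - x) < 1) (d : Vec n) :
    |fderiv ℝ f y d - fderiv ℝ f x d - hess f x (y - x) d| ≤
      localNorm f x (y - x) ^ 2 / (1 - localNorm f x (y - x)) * localNorm f x d := by
  set h := y - x with hh
  set r := localNorm f x h
  have hseg : ∀ s ∈ Icc (0 : ℝ) 1, x + s • h ∈ D := hf.add_smul_sub_mem hx hy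
  have hpos {s : ℝ} (hs : s ∈ Icc (0 : ℝ) 1) : 0 < 1 - r * s := one_sub_localNorm_mul_pos hr hs
  let φ (s : ℝ) := fderiv ℝ f (x + s • h) d - fderiv ℝ f x d - s * hess f x h d
  let B (s : ℝ) := ((1 - r * s)⁻¹ - 1 - r * s) * localNorm f x d
  have hφ (s : ℝ) (hs : s ∈ Icc (0 : ℝ) 1) :
      HasDerivAt φ (hess f (x + s • h) h d - hess f x h d) s := by
    have hgrad := hasDerivAt_comp_line_apply (h := h)
      (differentiableAt_fderiv hf.isOpen_dom hf.contDiffOn (hseg s hs)) d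
    simpa using! (hgrad.sub_const (fderiv ℝ f x d)).sub
      ((hasDerivAt_id s).mul_const (hess f x h d))
  have hB (s : ℝ) (hs : s ∈ Icc (0 : ℝ) 1) :
      HasDerivAt B ((((1 - r * s) ^ 2)⁻¹ - 1) * r * localNorm f x d) s := by
    have hlin : HasDerivAt (fun s : ℝ => r * s) r s := by
      simpa using (hasDerivAt_id s).const_mul r
    exact ((((hlin.const_sub 1).fun_inv (hpos hs).ne').sub_const 1).sub hlin).mul_const
      (localNorm f x d) |>.congr_deriv (by ring)
  have hle := image_norm_le_of_norm_deriv_right_le_deriv_boundary'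
    (fun s hs => (hφ s hs).continuousAt.continuousWithinAt)
    (fun s hs => (hφ s (Ico_subset_Icc_self hs)).hasDerivWithinAt) (by simp [φ, B])
    (fun s hs => (hB s hs).continuousAt.continuousWithinAt)
    (fun s hs => (hB s (Ico_subset_Icc_self hs)).hasDerivWithinAt)
    (fun s hs => hf.abs_hess_segment_sub_le hseg hr (Ico_subset_Icc_self hs) h d)
    (right_mem_Icc.2 zero_le_one)
  have hr1 : 1 - r ≠ 0 := (sub_pos.2 hr).ne'
  have hB1 : B 1 = r ^ 2 / (1 - r) * localNorm f x d := by
    simp only [B, mul_one]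
    field_simp
    ring
  simpa [φ, hB1, hh] using hle

theorem localNorm_sub_le_div_add (hf : IsSelfConcordant f D) (hx : x ∈ D) (hy : y ∈ D)
    (hr : localNorm f x (y - x) < 1) (z : Vec n) :
    localNorm f x (z - x) ≤
      localNorm f y (z - y) / (1 - localNorm f x (y - x)) + localNorm f x (y - x) := by
  have hadd := hf.localNorm_add_le hx (z - y) (y - x)
  rw [sub_add_sub_cancel] at hadd
  have hle := (le_div_iff₀ (sub_pos.2 hr)).2 (hf.mul_one_sub_le_localNorm hx hy hr (z - y))
  linarith

end IsSelfConcordant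

end SelfConcordant

section ProximalNewton

theorem toReal_segment_le {E : Type*} [AddCommGroup E] [Module ℝ E] {g : E → EReal}
    (hbot : ∀ x, g x ≠ ⊥) (hconv : Convex ℝ {p : E × ℝ | g p.1 ≤ (p.2 : EReal)}) {x y : E}
    (hx : g x < ⊤) (hy : g y < ⊤) {θ : ℝ} (hθ : θ ∈ Icc (0 : ℝ) 1) :
    g (x + θ • (y - x)) < ⊤ ∧
      (g (x + θ • (y - x))).toReal ≤ (g x).toReal + θ * ((g y).toReal - (g x).toReal) := by
  have hmem {z : E} (hz : g z < ⊤) : (z, (g z).toReal) ∈ {p : E × ℝ | g p.1 ≤ (p.2 : EReal)} :=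
    (EReal.coe_toReal hz.ne (hbot z)).ge
  have hle : g (x + θ • (y - x)) ≤
      (((g x).toReal + θ * ((g y).toReal - (g x).toReal) : ℝ) : EReal) :=
    hconv.add_smul_sub_mem (hmem hx) (hmem hy) hθ
  exact ⟨hle.trans_lt (EReal.coe_lt_top _),
    EReal.toReal_le_toReal hle (hbot _) (EReal.coe_ne_top _)⟩

variable {n : ℕ} {f : Vec n → ℝ} {D : Set (Vec n)} {g : Vec n → EReal} {t δ : ℝ}
  {xs x x' y : Vec n}

theorem convex_domF (hD : Convex ℝ D) (hbot : ∀ x, g x ≠ ⊥)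
    (hconv : Convex ℝ {p : Vec n × ℝ | g p.1 ≤ (p.2 : EReal)}) : Convex ℝ (domF D g) :=
  convex_iff_segment_subset.2 fun x hx y hy => by
    rw [segment_eq_image']
    rintro _ ⟨θ, hθ, rfl⟩
    exact ⟨hD.add_smul_sub_mem hx.1 hy.1 hθ, (toReal_segment_le hbot hconv hx.2 hy.2 hθ).1⟩

theorem IsExactSolution.neg_fderiv_le (hD : Convex ℝ D) (hbot : ∀ x, g x ≠ ⊥)
    (hconv : Convex ℝ {p : Vec n × ℝ | g p.1 ≤ (p.2 : EReal)}) (ht : 0 < t)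
    (hxs : IsExactSolution f D g t xs) (hf : DifferentiableAt ℝ f xs) (hy : y ∈ domF D g) :
    -fderiv ℝ f xs (y - xs) ≤ t⁻¹ * ((g y).toReal - (g xs).toReal) := by
  set G := t⁻¹ * ((g y).toReal - (g xs).toReal) with hG
  have hderiv : HasDerivAt (fun θ : ℝ => f (xs + θ • (y - xs)) + θ * G)
      (fderiv ℝ f xs (y - xs) + G) 0 := by
    have hline := hasDerivAt_comp_line (x := xs) (h := y - xs) (τ := 0) (by simpa using hf)
    simpa using hline.fun_add ((hasDerivAt_id (0 : ℝ)).mul_const G)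
  have hmin : IsMinOn (fun θ : ℝ => f (xs + θ • (y - xs)) + θ * G) (Icc 0 1) 0 := by
    refine isMinOn_iff.2 fun θ hθ => ?_
    have hobj := hxs.2 _ ((convex_domF hD hbot hconv).add_smul_sub_mem hxs.1 hy hθ)
    have hseg := mul_le_mul_of_nonneg_left (toReal_segment_le hbot hconv hxs.1.2 hy.2 hθ).2
      (inv_pos.2 ht).le
    simp only [objective] at hobj
    simp only [zero_smul, add_zero, zero_mul, hG]
    linarith
  have hnonneg := hmin.localize.hasFDerivWithinAt_nonneg (y := (1 : ℝ))
    hderiv.hasFDerivAt.hasFDerivWithinAt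
    (mem_posTangentConeAt_of_segment_subset (by simp [segment_eq_Icc]))
  simp only [ContinuousLinearMap.toSpanSingleton_apply, one_smul] at hnonneg
  linarith

theorem quadModel_sub_quadModel_segment (hsymm : IsSymmSndFDerivAt ℝ f x) (x' y : Vec n) (θ : ℝ) :
    quadModel f x x' - quadModel f x (x' + θ • (y - x')) =
      θ * (fderiv ℝ f x (x' - y) + hess f x (y - x) (x' - y)) +
        (θ - θ ^ 2 / 2) * hess f x (x' - y) (x' - y) := by
  obtain ⟨d, rfl⟩ : ∃ d, x' = y + d := ⟨x' - y, by abel⟩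
  obtain ⟨h, rfl⟩ : ∃ h, y = x + h := ⟨y - x, by abel⟩
  have hend : x + h + d - x = h + d := by abel
  have hmid : x + h + d + θ • (x + h - (x + h + d)) - x = h + d - θ • d := by module
  simp only [quadModel, hess, hend, hmid, add_sub_cancel_left, map_add, map_sub, map_smul,
    add_apply, sub_apply, smul_apply, smul_eq_mul, hsymm d h]
  ring

theorem le_add_of_forall_quadratic_le {N ε : ℝ} (hε : 0 ≤ ε) (hδ : 0 ≤ δ)
    (h : ∀ θ ∈ Icc (0 : ℝ) 1, θ * (N ^ 2 - ε * N) - θ ^ 2 / 2 * N ^ 2 ≤ δ ^ 2 / 2) :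
    N ≤ ε + δ := by
  rcases le_total N ε with hle | hle
  · linarith
  rcases (hε.trans hle).eq_or_lt with rfl | hN
  · linarith
  have hopt := h ((N - ε) / N)
    ⟨div_nonneg (sub_nonneg.2 hle) hN.le, (div_le_one hN).2 (sub_le_self N hε)⟩
  rw [show (N - ε) / N * (N ^ 2 - ε * N) - ((N - ε) / N) ^ 2 / 2 * N ^ 2 = (N - ε) ^ 2 / 2 by
    field_simp; ring] at hopt
  linarith [le_of_sq_le_sq (by linarith : (N - ε) ^ 2 ≤ δ ^ 2) hδ]

theorem IsInexactStep.localNorm_sub_le (hf : IsSelfConcordant f D) (hbot : ∀ x, g x ≠ ⊥)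
    (hconv : Convex ℝ {p : Vec n × ℝ | g p.1 ≤ (p.2 : EReal)}) (ht : 0 < t) (hδ : 0 ≤ δ)
    (hxs : IsExactSolution f D g t xs) (hx : x ∈ D) (hx' : IsInexactStep f D g t δ x x')
    (hr : localNorm f x (xs - x) < 1) :
    localNorm f x (x' - xs) ≤
      localNorm f x (xs - x) ^ 2 / (1 - localNorm f x (xs - x)) + δ := by
  have hD := hf.convexOn.1
  have hdiff : DifferentiableAt ℝ f xs :=
    (hf.contDiffOn.contDiffAt (hf.isOpen_dom.mem_nhds hxs.1.1)).differentiableAt three_ne_zero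
  set ε := localNorm f x (xs - x) ^ 2 / (1 - localNorm f x (xs - x))
  have hgrad : fderiv ℝ f xs (x' - xs) - fderiv ℝ f x (x' - xs) - hess f x (xs - x) (x' - xs) ≤
      ε * localNorm f x (x' - xs) :=
    (abs_le.1 (hf.abs_fderiv_sub_sub_hess_le hx hxs.1.1 hr (x' - xs))).2
  have hopt := hxs.neg_fderiv_le hD hbot hconv ht hdiff hx'.1
  -- Compare `x'` with the points of the segment from `x'` to `xs`.
  refine le_add_of_forall_quadratic_le (div_nonneg (sq_nonneg _) (sub_pos.2 hr).le) hδ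
    fun θ hθ => ?_
  have hstep := hx'.2 _ ((convex_domF hD hbot hconv).add_smul_sub_mem hx'.1 hxs.1 hθ)
  have hseg := mul_le_mul_of_nonneg_left (toReal_segment_le hbot hconv hx'.1.2 hxs.1.2 hθ).2
    (inv_pos.2 ht).le
  have hquad := quadModel_sub_quadModel_segment
    (isSymmSndFDerivAt_of_contDiffOn hf.isOpen_dom hf.contDiffOn hx) x' xs θ
  rw [← hf.localNorm_sq hx] at hquad
  simp only [model] at hstep
  linarith [mul_le_mul_of_nonneg_left hgrad hθ.1, mul_le_mul_of_nonneg_left hopt hθ.1]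

theorem IsInexactStep.localNorm_sub_exactSolution_le (hf : IsSelfConcordant f D)
    (hbot : ∀ x, g x ≠ ⊥) (hconv : Convex ℝ {p : Vec n × ℝ | g p.1 ≤ (p.2 : EReal)})
    (ht : 0 < t) (hδ : 0 ≤ δ) (hxs : IsExactSolution f D g t xs) (hx : x ∈ D)
    (hx' : IsInexactStep f D g t δ x x') (hlam : localNorm f xs (x - xs) < 1 / 2) :
    localNorm f xs (x' - xs) ≤
      localNorm f xs (x - xs) ^ 2 /
          ((1 - localNorm f xs (x - xs)) ^ 2 * (1 - 2 * localNorm f xs (x - xs))) +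
        δ / (1 - localNorm f xs (x - xs)) := by
  have hlam1 : localNorm f xs (x - xs) < 1 := by linarith
  have hr := hf.localNorm_mul_one_sub_le hxs.1.1 hx hlam1 (x - xs)
  have hback := hf.mul_one_sub_le_localNorm hxs.1.1 hx hlam1 (x' - xs)
  set lam := localNorm f xs (x - xs)
  have hpos : 0 < 1 - lam := sub_pos.2 hlam1
  rw [localNorm_sub_comm, ← le_div_iff₀ hpos] at hr
  have hratio : lam / (1 - lam) < 1 := (div_lt_one hpos).2 (by linarith)
  have hstep := hx'.localNorm_sub_le hf hbot hconv ht hδ hxs hx (hr.trans_lt hratio)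
  have hr0 := localNorm_nonneg f x (xs - x)
  calc localNorm f xs (x' - xs) ≤ localNorm f x (x' - xs) / (1 - lam) :=
        (le_div_iff₀ hpos).2 hback
    _ ≤ ((lam / (1 - lam)) ^ 2 / (1 - lam / (1 - lam)) + δ) / (1 - lam) := by
        gcongr
        refine hstep.trans ?_
        gcongr
    _ = lam ^ 2 / ((1 - lam) ^ 2 * (1 - 2 * lam)) + δ / (1 - lam) := by
        have hratio' : 1 - lam / (1 - lam) = (1 - 2 * lam) / (1 - lam) := by field_simp; ring
        rw [hratio']
        field_simp

end ProximalNewton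

section Numerics

theorem div_one_sub_add_le_mul_sqrt {β Δ c : ℝ} (hc : 0 < c) (hβ : 0 ≤ β)
    (hΔ : Δ ≤ (√β - c * β) / (c + √β)) : Δ < 1 ∧ β / (1 - Δ) + Δ ≤ 1 / c * √β := by
  obtain ⟨s, hs, rfl⟩ : ∃ s : ℝ, 0 ≤ s ∧ β = s ^ 2 := ⟨√β, sqrt_nonneg β, (sq_sqrt hβ).symm⟩
  rw [sqrt_sq hs] at hΔ ⊢
  have hΔ' : c * (1 + s ^ 2) / (c + s) ≤ 1 - Δ := by
    rw [show (s - c * s ^ 2) / (c + s) = 1 - c * (1 + s ^ 2) / (c + s) by field_simp; ring] at hΔ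
    linarith
  have hpos : 0 < 1 - Δ := lt_of_lt_of_le (by positivity) hΔ'
  refine ⟨sub_pos.1 hpos, ?_⟩
  have hgap : 1 / c * s - (s ^ 2 / (c * (1 + s ^ 2) / (c + s)) + (s - c * s ^ 2) / (c + s)) =
      s ^ 2 * (1 - c * s) ^ 2 / (c * (1 + s ^ 2) * (c + s)) := by
    field_simp
    ring
  calc s ^ 2 / (1 - Δ) + Δ ≤ s ^ 2 / (c * (1 + s ^ 2) / (c + s)) + (s - c * s ^ 2) / (c + s) := by
        gcongr
    _ ≤ 1 / c * s := by rw [← sub_nonneg, hgap]; positivity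

theorem newton_error_le_of_le_sqrt {β δ lam : ℝ} (hβ : β ≤ 0.15) (hlam0 : 0 ≤ lam)
    (hlam : lam ≤ 1 / 2.581 * √β) (hδ : δ ≤ 0.075 * β) (hβ0 : 0 ≤ β) :
    lam < 1 / 2 ∧ lam ^ 2 / ((1 - lam) ^ 2 * (1 - 2 * lam)) + δ / (1 - lam) ≤ β := by
  have hsq : lam ^ 2 ≤ 0.1502 * β := by
    have hpow := pow_le_pow_left₀ hlam0 hlam 2
    rw [mul_pow, sq_sqrt hβ0] at hpow
    norm_num at hpow ⊢
    linarith
  have hlam1 : lam ≤ 0.1511 := le_of_sq_le_sq (by norm_num at hsq hβ ⊢; linarith) (by norm_num)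
  have hden : (0.5 : ℝ) ≤ (1 - lam) ^ 2 * (1 - 2 * lam) :=
    calc (0.5 : ℝ) ≤ (1 - 0.1511) ^ 2 * (1 - 2 * 0.1511) := by norm_num
      _ ≤ (1 - lam) ^ 2 * (1 - 2 * lam) := by
        gcongr
  refine ⟨by linarith, ?_⟩
  calc lam ^ 2 / ((1 - lam) ^ 2 * (1 - 2 * lam)) + δ / (1 - lam)
      ≤ 0.1502 * β / 0.5 + 0.075 * β / 0.8 := by
        gcongr
        linarith
    _ ≤ β := by norm_num; linarith

end Numerics

end ProxNewton

theorem theorem4p1_general {n : ℕ} {f : ProxNewton.Vec n → ℝ} {D : Set (ProxNewton.Vec n)}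
    {g : ProxNewton.Vec n → EReal} (hf : ProxNewton.IsSelfConcordant f D) (hbot : ∀ x, g x ≠ ⊥)
    (hconv : Convex ℝ {p : ProxNewton.Vec n × ℝ | g p.1 ≤ (p.2 : EReal)})
    {β t δ : ℝ} (hβ : β ≤ 0.15) (ht : 0 < t) {xs xs' x x' : ProxNewton.Vec n} (hxs : xs ∈ D)
    (hxs' : ProxNewton.IsExactSolution f D g t xs') (hx : x ∈ D) (hδ0 : 0 ≤ δ)
    (hx' : ProxNewton.IsInexactStep f D g t δ x x') (hδ : δ ≤ 0.075 * β)
    (hΔ : ProxNewton.localNorm f xs' (xs' - xs) ≤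
      (Real.sqrt β - 2.581 * β) / (2.581 + Real.sqrt β))
    (hlam : ProxNewton.localNorm f xs (x - xs) ≤ β) :
    ProxNewton.localNorm f xs' (x - xs') ≤ 1 / 2.581 * Real.sqrt β ∧
      ProxNewton.localNorm f xs' (x' - xs') ≤ β ∧
      x' ∈ ProxNewton.quadRegion f D g xs' β := by
  have hβ0 : 0 ≤ β := (ProxNewton.localNorm_nonneg f xs (x - xs)).trans hlam
  obtain ⟨hΔ1, hnum⟩ := ProxNewton.div_one_sub_add_le_mul_sqrt (by norm_num) hβ0 hΔ
  rw [ProxNewton.localNorm_sub_comm] at hΔ1 hnum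
  have hstart : ProxNewton.localNorm f xs' (x - xs') ≤ 1 / 2.581 * Real.sqrt β :=
    calc ProxNewton.localNorm f xs' (x - xs') ≤
          ProxNewton.localNorm f xs (x - xs) / (1 - ProxNewton.localNorm f xs' (xs - xs')) +
            ProxNewton.localNorm f xs' (xs - xs') :=
          hf.localNorm_sub_le_div_add hxs'.1.1 hxs hΔ1 x
      _ ≤ β / (1 - ProxNewton.localNorm f xs' (xs - xs')) +
            ProxNewton.localNorm f xs' (xs - xs') := by gcongr
      _ ≤ 1 / 2.581 * Real.sqrt β := hnum
  obtain ⟨hhalf, herr⟩ := ProxNewton.newton_error_le_of_le_sqrt hβ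
    (ProxNewton.localNorm_nonneg f xs' (x - xs')) hstart hδ hβ0
  have hend : ProxNewton.localNorm f xs' (x' - xs') ≤ β :=
    (hx'.localNorm_sub_exactSolution_le hf hbot hconv ht hδ0 hxs' hx hhalf).trans herr
  exact ⟨hstart, hend, hx'.1, hend⟩

theorem theorem4p1 {n : ℕ}
    (f : ProxNewton.Vec n → ℝ) (D : Set (ProxNewton.Vec n)) (g : ProxNewton.Vec n → EReal)
    (ν : ℝ) (hf : ProxNewton.IsSelfConcordantBarrier f D ν)
    (hpos : ∀ x ∈ D, ∀ u : ProxNewton.Vec n, u ≠ 0 → 0 < ProxNewton.hess f x u u)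
    (hg : ProxNewton.IsProperClosedConvex g)
    (β : ℝ) (hβ : β ∈ Set.Ioc (0 : ℝ) 0.15)
    (t t' : ℝ) (ht : 0 < t) (ht' : 0 < t')
    (xs xs' : ProxNewton.Vec n)
    (hxs : ProxNewton.IsExactSolution f D g t xs)
    (hxs' : ProxNewton.IsExactSolution f D g t' xs')
    (x x' : ProxNewton.Vec n) (hx : x ∈ ProxNewton.domF D g)
    (δ : ℝ) (hδ0 : 0 ≤ δ) (hx' : ProxNewton.IsInexactStep f D g t' δ x x')
    (hδ : δ ≤ 0.075 * β)
    (hΔ : ProxNewton.localNorm f xs' (xs' - xs) ≤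
      (Real.sqrt β - 2.581 * β) / (2.581 + Real.sqrt β))
    (hlam : ProxNewton.localNorm f xs (x - xs) ≤ β) :
    ProxNewton.localNorm f xs' (x - xs') ≤ 1 / 2.581 * Real.sqrt β ∧
      ProxNewton.localNorm f xs' (x' - xs') ≤ β ∧
      x' ∈ ProxNewton.quadRegion f D g xs' β := by
  exact theorem4p1_general hf.selfConcordant hg.ne_bot hg.convex_epigraph hβ.2 ht' hxs.1.1 hxs' hx.1
    hδ0 hx' hδ hΔ hlam
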